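/- \textbf{Corollary 1 (Random points I).} Let $0<p<1/2$ and let $d\ge 1$ be an integer. There is a constant $c=c_{p,d}>0$, depending only on $p$ and $d$, such that the following holds for every integer $n\ge 1$ (with $n\ge 2$ if $d=2$). Let $x_1,\dots,x_n$ (red) and $y_1,\dots,y_n$ (blue) be $2n$ independent random points, each uniformly distributed on $[0,1]^d$. Let $\pi$ be a (random) permutation of $\{1,\dots,n\}$ produced by the greedy algorithm for the cost $c(x,y)=\|x-y\|^p$, where $\|\cdot\|$ is the Euclidean norm: among the points still present choose a pair $(x_i,y_j)$ minimizing $c(x_i,y_j)$ (ties, if any, being broken in an arbitrary measurable way), set $\pi(i)=j$, remove $x_i$ and $y_j$, and repeat until no points are left. Then the greedy cost $\mathrm{Greedy}_p(X,Y)=\sum_{i=1}^n\|x_i-y_{\pi(i)}\|^p$ is integrable and $$\mathbb E\,\mathrm{Greedy}_p(X,Y)\le c_{p,d}\cdot\begin{cases} n^{1-p/2} & \text{if } d=1,\\ n^{1-p/2}(\log n)^{p/2} & \text{if } d=2,\\ n^{1-p/d} & \text{if } d\ge 3.\end{cases}$$ -/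

import Mathlib

open MeasureTheory ProbabilityTheory

/-- `GreedyRun c π S T`: started with the red points (indexed by) `S` and the blue points `T`
still present, some run of the greedy algorithm for the cost `c` produces the matching `π`.
In each step one picks a remaining pair `(i, j)` of minimal cost (ties may be broken arbitrarily),
sets `π i = j`, removes `i` from `S` and `j` from `T`, and repeats until no point is left. -/
inductive GreedyRun {n : ℕ} (c : Fin n → Fin n → ℝ) (π : Equiv.Perm (Fin n)) :
    Finset (Fin n) → Finset (Fin n) → Prop
  | done : GreedyRun c π ∅ ∅
  | step {S T : Finset (Fin n)} (i j : Fin n) (hi : i ∈ S) (hj : j ∈ T)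
      (hmin : ∀ i' ∈ S, ∀ j' ∈ T, c i j ≤ c i' j') (hπ : π i = j)
      (hrest : GreedyRun c π (S.erase i) (T.erase j)) : GreedyRun c π S T

/-- `π` is a greedy matching of `x 0, …, x (n-1)` to `y 0, …, y (n-1)` for the cost
`‖x - y‖ ^ p` (the Euclidean norm). -/
def IsGreedyMatching {d n : ℕ} (p : ℝ) (x y : Fin n → EuclideanSpace ℝ (Fin d))
    (π : Equiv.Perm (Fin n)) : Prop :=
  GreedyRun (fun i j => ‖x i - y j‖ ^ p) π Finset.univ Finset.univ

/-- The cost `∑ i, ‖x i - y (π i)‖ ^ p` of the matching `π`. -/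
noncomputable def matchingCost {d n : ℕ} (p : ℝ) (x y : Fin n → EuclideanSpace ℝ (Fin d))
    (π : Equiv.Perm (Fin n)) : ℝ :=
  ∑ i, ‖x i - y (π i)‖ ^ p

/-- The unit cube `[0,1]^d` in Euclidean space. -/
def unitCube (d : ℕ) : Set (EuclideanSpace ℝ (Fin d)) :=
  {x | ∀ i, x i ∈ Set.Icc (0 : ℝ) 1}

/-! Let `D` bound `∑ f (red) - ∑ f (blue)` over all 1-Lipschitz `f`. With `k` points of each colour
left and current bound `D_k`, testing with the distance to the blue set shows that the closest pair
is at distance at most `D_k / k`. Deleting that pair raises the bound by at most its distance, so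
`D_(k-1) = D_k * (k + 1) / k` is admissible and `D_k * (k + 1)` stays constant. The pair removed at
stage `k` therefore costs at most `(D * (n + 1) / (k * (k + 1))) ^ p`; since `2 * p < 1`, these
terms sum to `O(n ^ (1 - p) * D ^ p)` (`GreedyRun.cost_le`, `matchingCost_le_of_isGreedyMatching`).

It remains to bound the second moment of `D`. The cube is rounded to a grid of mesh `1 / N`, and the
torus of period `2 * N` is folded onto this grid by reflection, so that Lipschitz functions pull
back to Lipschitz functions without boundary terms. On the torus, Parseval and Cauchy-Schwarz bound
`D ^ 2` by a sum over nonzero frequencies of `‖A k‖ ^ 2 / torusSymbol k`, with `A k` the difference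
of the empirical character sums (`sq_sum_sub_le_torus`). Independence and equality of laws give `E
‖A k‖ ^ 2 ≤ 4 * n`, and counting frequencies by size `r` leaves `n * ∑ r ^ (d - 3)` for `r ≤ N`:
bounded, logarithmic or polynomial sums for `d = 1`, `d = 2`, `d ≥ 3`. The rounding error is
balanced against this sum in `exists_scale`. -/

/-! ### The greedy algorithm -/

/-- If `D` bounds the dual Kantorovich functional of two finite families of equal cardinality, then
their minimal distance is at most `D` divided by the cardinality. -/
theorem card_mul_le_of_dual_bound {ι E : Type*} [SeminormedAddCommGroup E] {x y : ι → E}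
    {S T : Finset ι} (hT : T.Nonempty) {D δ : ℝ}
    (hD : ∀ f : E → ℝ, LipschitzWith 1 f → ∑ i ∈ S, f (x i) - ∑ j ∈ T, f (y j) ≤ D)
    (hδ : ∀ i ∈ S, ∀ j ∈ T, δ ≤ ‖x i - y j‖) : S.card * δ ≤ D := by
  -- The test function is the distance to the blue points: zero on them, at least `δ` on each red
  -- point.
  have h := hD _ (Metric.lipschitz_infDist_pt (y '' (T : Set ι)))
  have h0 : ∑ j ∈ T, Metric.infDist (y j) (y '' (T : Set ι)) = 0 :=
    Finset.sum_eq_zero fun j hj => Metric.infDist_zero_of_mem (Set.mem_image_of_mem _ hj)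
  have h1 : ∑ i ∈ S, δ ≤ ∑ i ∈ S, Metric.infDist (x i) (y '' (T : Set ι)) := by
    refine Finset.sum_le_sum fun i hi => ?_
    rw [Metric.le_infDist ((Finset.coe_nonempty.2 hT).image _)]
    rintro _ ⟨j, hj, rfl⟩
    rw [dist_eq_norm]
    exact hδ i hi j hj
  rw [Finset.sum_const, nsmul_eq_mul] at h1
  linarith

/-- The cost of a run of the greedy algorithm is controlled by the dual Kantorovich functional. -/
theorem GreedyRun.cost_le {E : Type*} [SeminormedAddCommGroup E] {n : ℕ} {p : ℝ} (hp : 0 < p)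
    {x y : Fin n → E} {π : Equiv.Perm (Fin n)} {S T : Finset (Fin n)}
    (h : GreedyRun (fun i j => ‖x i - y j‖ ^ p) π S T) :
    ∀ D : ℝ, (∀ f : E → ℝ, LipschitzWith 1 f → ∑ i ∈ S, f (x i) - ∑ j ∈ T, f (y j) ≤ D) →
      ∑ i ∈ S, ‖x i - y (π i)‖ ^ p ≤ D ^ p * (((S.card : ℝ) + 1) ^ p *
        ∑ j ∈ Finset.range S.card, ((((j : ℝ) + 1) * (j + 2)) ^ p)⁻¹) := by
  induction h with
  | done => intro D _; simp
  | @step S T i j hi hj hmin hπ hrest ih =>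
    intro D hD
    have hcard := Finset.card_erase_add_one hi
    set m := (S.erase i).card with hm
    have hD0 : 0 ≤ D := by simpa using hD (fun _ => 0) (LipschitzWith.const' 0)
    have hδ : ((m : ℝ) + 1) * ‖x i - y j‖ ≤ D := by
      have := card_mul_le_of_dual_bound ⟨j, hj⟩ hD (fun i' hi' j' hj' =>
        (Real.rpow_le_rpow_iff (norm_nonneg _) (norm_nonneg _) hp).1 (hmin i' hi' j' hj'))
      rw [← hcard] at this
      exact_mod_cast this
    have hm0 : (0 : ℝ) < (m : ℝ) + 1 := by positivity
    have hδ' : ‖x i - y j‖ ≤ D / (m + 1) := by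
      rw [le_div_iff₀ hm0]; linarith
    -- Deleting the pair changes the functional by `f (y j) - f (x i)`, at most its distance, hence
    -- at most `D / (m + 1)`.
    have key := ih (D * (m + 2) / (m + 1)) (by
      intro f hf
      have h1 := hD f hf
      rw [← Finset.add_sum_erase S _ hi, ← Finset.add_sum_erase T _ hj] at h1
      have h2 : f (y j) - f (x i) ≤ ‖x i - y j‖ := by
        have := hf.dist_le_mul (y j) (x i)
        rw [Real.dist_eq, dist_comm, dist_eq_norm] at this
        have h3 := le_abs_self (f (y j) - f (x i))
        simp at this
        linarith
      have h3 : D * (m + 2) / (m + 1) = D + D / (m + 1) := by field_simp; ring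
      rw [h3]; linarith)
    rw [← Finset.add_sum_erase S _ hi, ← hcard, Finset.sum_range_succ, hπ]
    have e1 : ‖x i - y j‖ ^ p ≤ D ^ p * (((m + 1 : ℕ) : ℝ) + 1) ^ p *
        ((((m : ℝ) + 1) * (m + 2)) ^ p)⁻¹ := by
      refine (Real.rpow_le_rpow (norm_nonneg _) hδ' hp.le).trans (le_of_eq ?_)
      rw [← Real.mul_rpow hD0 (by positivity), ← Real.inv_rpow (by positivity),
        ← Real.mul_rpow (by positivity) (by positivity)]
      congr 1
      push_cast
      field_simp
      ring
    -- The product of the dual bound and (number of remaining pairs + 1) is the same before and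
    -- after the step.
    have e2 : (D * (m + 2) / (m + 1)) ^ p * ((m : ℝ) + 1) ^ p =
        D ^ p * (((m + 1 : ℕ) : ℝ) + 1) ^ p := by
      rw [← Real.mul_rpow (by positivity) (by positivity), ← Real.mul_rpow hD0 (by positivity)]
      congr 1
      push_cast
      field_simp
      ring
    rw [← mul_assoc, e2] at key
    calc _ ≤ _ := add_le_add e1 key
      _ = _ := by ring

/-- Comparison with the integral of `t ^ (-s)`; Bernoulli's inequality for the exponent `1 - s ≤ 1`
replaces the integral in the induction step. -/
theorem sum_rpow_neg_le {s : ℝ} (h0 : 0 ≤ s) (h1 : s < 1) (n : ℕ) :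
    ∑ j ∈ Finset.range n, (((j : ℝ) + 1) ^ s)⁻¹ ≤ (n : ℝ) ^ (1 - s) / (1 - s) := by
  have hs : 0 < 1 - s := by linarith
  induction n with
  | zero => simp [Real.zero_rpow hs.ne']
  | succ n ih =>
    rw [Finset.sum_range_succ]
    refine (add_le_add_left ih _).trans ?_
    push_cast
    rw [← sub_nonneg]
    have hn : (0 : ℝ) < (n : ℝ) + 1 := by positivity
    have hb := rpow_one_add_le_one_add_mul_self (s := -1 / ((n : ℝ) + 1))
      (by rw [le_div_iff₀ hn]; linarith [n.cast_nonneg (α := ℝ)]) hs.le (by linarith)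
    have e : 1 + -1 / ((n : ℝ) + 1) = n / (n + 1) := by field_simp; ring
    rw [e, Real.div_rpow (by positivity) hn.le, div_le_iff₀ (by positivity)] at hb
    have e2 : (((n : ℝ) + 1) ^ s)⁻¹ = ((n : ℝ) + 1) ^ (1 - s) / (n + 1) := by
      rw [Real.rpow_sub hn, Real.rpow_one]; field_simp
    rw [e2]
    have e3 : ((n : ℝ) + 1) ^ (1 - s) / (1 - s) - ((n : ℝ) ^ (1 - s) / (1 - s) +
        ((n : ℝ) + 1) ^ (1 - s) / (n + 1)) =
        ((1 + (1 - s) * (-1 / ((n : ℝ) + 1))) * (n + 1) ^ (1 - s) - (n : ℝ) ^ (1 - s))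
          / (1 - s) := by
      field_simp; ring
    rw [e3]
    exact div_nonneg (sub_nonneg.2 hb) hs.le

/-- The greedy matching for `‖x - y‖ ^ p` costs at most a constant times `n ^ (1 - p) * D ^ p`,
where `D` bounds the dual Kantorovich functional. -/
theorem matchingCost_le_of_isGreedyMatching {d n : ℕ} {p : ℝ} (hp0 : 0 < p) (hp : p < 1 / 2)
    (hn : 1 ≤ n) {x y : Fin n → EuclideanSpace ℝ (Fin d)} {π : Equiv.Perm (Fin n)}
    (h : IsGreedyMatching p x y π) {D : ℝ}
    (hD : ∀ f : EuclideanSpace ℝ (Fin d) → ℝ, LipschitzWith 1 f →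
      ∑ i, f (x i) - ∑ i, f (y i) ≤ D) :
    matchingCost p x y π ≤ 2 ^ p / (1 - 2 * p) * (n : ℝ) ^ (1 - p) * D ^ p := by
  have hD0 : 0 ≤ D := by simpa using hD (fun _ => 0) (LipschitzWith.const' 0)
  have hn' : (1 : ℝ) ≤ n := by exact_mod_cast hn
  refine (GreedyRun.cost_le hp0 h D hD).trans ?_
  rw [Finset.card_univ, Fintype.card_fin, mul_comm]
  refine mul_le_mul_of_nonneg_right ?_ (by positivity)
  have h1 : ((n : ℝ) + 1) ^ p ≤ 2 ^ p * (n : ℝ) ^ p := by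
    rw [← Real.mul_rpow (by norm_num) (by positivity)]
    exact Real.rpow_le_rpow (by positivity) (by linarith) hp0.le
  -- Each term is at most `(j + 1) ^ (-2 * p)`; `p < 1 / 2` keeps this exponent above `-1`.
  have h2 : ∑ j ∈ Finset.range n, ((((j : ℝ) + 1) * (j + 2)) ^ p)⁻¹ ≤
      (n : ℝ) ^ (1 - 2 * p) / (1 - 2 * p) := by
    refine (Finset.sum_le_sum fun j _ => ?_).trans
      (sum_rpow_neg_le (s := 2 * p) (by linarith) (by linarith) n)
    rw [Real.rpow_mul (by positivity)]
    refine inv_anti₀ (by positivity) (Real.rpow_le_rpow (by positivity) ?_ hp0.le)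
    rw [Real.rpow_two]
    nlinarith [j.cast_nonneg (α := ℝ)]
  calc _ ≤ 2 ^ p * (n : ℝ) ^ p * ((n : ℝ) ^ (1 - 2 * p) / (1 - 2 * p)) :=
        mul_le_mul h1 h2 (Finset.sum_nonneg fun _ _ => by positivity) (by positivity)
    _ = _ := by
        have : (n : ℝ) ^ (1 - p) = (n : ℝ) ^ p * (n : ℝ) ^ (1 - 2 * p) := by
          rw [← Real.rpow_add (by linarith)]; ring_nf
        rw [this]; ring

/-! ### Fourier analysis on the discrete torus -/

section DiscreteTorus

variable {d M : ℕ} [NeZero M]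

/-- The character with frequency `k` of the discrete torus `(ℤ/M)^d`. -/
noncomputable def torusChar (k q : Fin d → ZMod M) : ℂ := ZMod.stdAddChar (k ⬝ᵥ q)

theorem torusChar_comm (k q : Fin d → ZMod M) : torusChar k q = torusChar q k := by
  simp [torusChar, dotProduct_comm]

theorem torusChar_add (k q r : Fin d → ZMod M) :
    torusChar k (q + r) = torusChar k q * torusChar k r := by
  simp [torusChar, dotProduct_add, AddChar.map_add_eq_mul]

theorem norm_torusChar (k q : Fin d → ZMod M) : ‖torusChar k q‖ = 1 := by
  simp [torusChar]

theorem torusChar_neg (k q : Fin d → ZMod M) :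
    torusChar k (-q) = starRingEnd ℂ (torusChar k q) := by
  simp [torusChar, AddChar.map_neg_eq_conj]

theorem torusChar_zero_left (q : Fin d → ZMod M) : torusChar 0 q = 1 := by
  simp [torusChar]

theorem sum_torusChar (q : Fin d → ZMod M) :
    ∑ k, torusChar k q = if q = 0 then (M : ℂ) ^ d else 0 := by
  split_ifs with h
  · subst h
    simp [torusChar, ZMod.card]
  · obtain ⟨j, hj⟩ := Function.ne_iff.1 h
    let ψ : AddChar (Fin d → ZMod M) ℂ :=
      { toFun := fun k => torusChar k q
        map_zero_eq_one' := torusChar_zero_left q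
        map_add_eq_mul' := fun k l => by
          rw [torusChar_comm, torusChar_add, torusChar_comm q, torusChar_comm q] }
    refine AddChar.sum_eq_zero_of_ne_one (ψ := ψ) fun hψ => ?_
    have hprim := ZMod.isPrimitive_stdAddChar M hj
    refine hprim (DFunLike.ext _ _ fun a => ?_)
    have := DFunLike.congr_fun hψ (Pi.single j a)
    simpa [ψ, torusChar, AddChar.mulShift_apply, mul_comm] using this

/-- The (unnormalised) Fourier transform on the discrete torus. -/
noncomputable def torusFourier (F : (Fin d → ZMod M) → ℂ) (k : Fin d → ZMod M) : ℂ :=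
  ∑ q, F q * torusChar k (-q)

theorem torusFourier_inversion (F : (Fin d → ZMod M) → ℂ) (q : Fin d → ZMod M) :
    (M : ℂ) ^ d * F q = ∑ k, torusFourier F k * torusChar k q := by
  simp only [torusFourier, Finset.sum_mul, mul_assoc, ← torusChar_add]
  rw [Finset.sum_comm]
  simp only [← Finset.mul_sum, sum_torusChar, neg_add_eq_zero]
  simp [mul_comm]

theorem torusFourier_parseval (F : (Fin d → ZMod M) → ℂ) :
    ∑ k, ‖torusFourier F k‖ ^ 2 = (M : ℝ) ^ d * ∑ q, ‖F q‖ ^ 2 := by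
  have h : ∑ k, torusFourier F k * starRingEnd ℂ (torusFourier F k) =
      (M : ℂ) ^ d * ∑ q, F q * starRingEnd ℂ (F q) := by
    have h1 : ∀ k, torusFourier F k * starRingEnd ℂ (torusFourier F k) =
        ∑ q, torusFourier F k * torusChar k q * starRingEnd ℂ (F q) := by
      intro k
      have h2 : starRingEnd ℂ (torusFourier F k) =
          ∑ q, starRingEnd ℂ (F q) * torusChar k q := by
        rw [torusFourier, map_sum]
        refine Finset.sum_congr rfl fun q _ => ?_
        rw [map_mul, ← torusChar_neg, neg_neg]
      rw [h2, Finset.mul_sum]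
      exact Finset.sum_congr rfl fun q _ => by ring
    simp only [h1]
    rw [Finset.sum_comm, Finset.mul_sum]
    refine Finset.sum_congr rfl fun q _ => ?_
    rw [← Finset.sum_mul, ← torusFourier_inversion]
    ring
  simp only [Complex.mul_conj'] at h
  exact_mod_cast h

/-- Differences become multipliers, so Parseval turns the sum of squared increments into a sum
weighted by `torusSymbol`. -/
theorem torusFourier_shift (F : (Fin d → ZMod M) → ℂ) (e k : Fin d → ZMod M) :
    torusFourier (fun q => F (q + e) - F q) k = (torusChar k e - 1) * torusFourier F k := by
  have h : ∑ q, F (q + e) * torusChar k (-q) = torusChar k e * torusFourier F k := by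
    rw [torusFourier, Finset.mul_sum]
    refine Fintype.sum_equiv (Equiv.addRight e) _ _ fun q => ?_
    have : -q = e + -(q + e) := by abel
    conv_lhs => rw [this, torusChar_add]
    simp only [Equiv.coe_addRight]
    ring
  simp only [torusFourier, sub_mul, Finset.sum_sub_distrib]
  rw [h]
  simp [torusFourier]

/-- The symbol of the discrete Laplacian. -/
noncomputable def torusSymbol (k : Fin d → ZMod M) : ℝ :=
  ∑ j, ‖torusChar k (Pi.single j 1) - 1‖ ^ 2

/-- The chord has length `2 * |sin (π * t)|`, and Jordan's inequality bounds the sine below. -/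
theorem four_mul_abs_le_norm_exp_sub_one {t : ℝ} (ht : |t| ≤ 1 / 2) :
    4 * |t| ≤ ‖Complex.exp (2 * Real.pi * Complex.I * t) - 1‖ := by
  have e : (2 * Real.pi * Complex.I * t : ℂ) = Complex.I * ((2 * Real.pi * t : ℝ) : ℂ) := by
    push_cast; ring
  rw [e, Complex.norm_exp_I_mul_ofReal_sub_one, norm_mul, Real.norm_eq_abs, Real.norm_eq_abs,
    abs_of_pos (by norm_num : (0 : ℝ) < 2)]
  have e2 : 2 * Real.pi * t / 2 = Real.pi * t := by ring
  have hpi := Real.pi_pos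
  have h := Real.mul_abs_le_abs_sin (x := Real.pi * t) (by
    rw [abs_mul, abs_of_pos hpi]; nlinarith)
  rw [e2]
  rw [abs_mul, abs_of_pos hpi] at h
  have e3 : 2 / Real.pi * (Real.pi * |t|) = 2 * |t| := by field_simp
  linarith

theorem sq_le_torusSymbol (k : Fin d → ZMod M) (j : Fin d) :
    16 * ((k j).valMinAbs.natAbs : ℝ) ^ 2 / (M : ℝ) ^ 2 ≤ torusSymbol k := by
  have hM : (0 : ℝ) < M := by exact_mod_cast Nat.pos_of_ne_zero (NeZero.ne M)
  set a : ℤ := (k j).valMinAbs with ha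
  have h1 : torusChar k (Pi.single j 1) =
      Complex.exp (2 * Real.pi * Complex.I * ((a / M : ℝ) : ℂ)) := by
    have : k j = ((a : ℤ) : ZMod M) := by rw [ha, ZMod.coe_valMinAbs]
    rw [torusChar, dotProduct_single_one, this, ZMod.stdAddChar_coe]
    congr 1
    push_cast
    ring
  have h2 : |(a / M : ℝ)| ≤ 1 / 2 := by
    rw [abs_div, abs_of_pos hM, div_le_iff₀ hM, ← Int.cast_abs]
    have := ZMod.natAbs_valMinAbs_le (k j)
    have h3 : |a| * 2 ≤ (M : ℤ) := by rw [Int.abs_eq_natAbs]; omega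
    have h4 : ((|a| : ℤ) : ℝ) * 2 ≤ M := by exact_mod_cast h3
    linarith
  have h3 := four_mul_abs_le_norm_exp_sub_one h2
  rw [← h1] at h3
  have h4 := pow_le_pow_left₀ (by positivity) h3 2
  refine le_trans (le_of_eq ?_) (h4.trans
    (Finset.single_le_sum (f := fun j => ‖torusChar k (Pi.single j 1) - 1‖ ^ 2)
      (fun _ _ => by positivity) (Finset.mem_univ j)))
  rw [mul_pow, sq_abs, div_pow, Nat.cast_natAbs, Int.cast_abs, sq_abs]
  ring

theorem torusSymbol_pos {k : Fin d → ZMod M} (hk : k ≠ 0) : 0 < torusSymbol k := by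
  obtain ⟨j, hj⟩ := Function.ne_iff.1 hk
  refine lt_of_lt_of_le ?_ (sq_le_torusSymbol k j)
  have hM : (0 : ℝ) < M := by exact_mod_cast Nat.pos_of_ne_zero (NeZero.ne M)
  have : 0 < (k j).valMinAbs.natAbs :=
    Int.natAbs_pos.2 (by simpa [ZMod.valMinAbs_eq_zero] using hj)
  have : (0 : ℝ) < ((k j).valMinAbs.natAbs : ℝ) := by exact_mod_cast this
  positivity

/-- The Dirichlet energy of a Lipschitz function on the discrete torus, in Fourier space. -/
theorem sum_torusSymbol_mul_le {F : (Fin d → ZMod M) → ℝ} {L : ℝ}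
    (hF : ∀ q j, |F (q + Pi.single j 1) - F q| ≤ L) :
    ∑ k, torusSymbol k * ‖torusFourier (fun q => (F q : ℂ)) k‖ ^ 2 ≤
      d * L ^ 2 * ((M : ℝ) ^ d) ^ 2 := by
  have h1 : ∀ j : Fin d, ∑ k, ‖torusChar k (Pi.single j 1) - 1‖ ^ 2 *
      ‖torusFourier (fun q => (F q : ℂ)) k‖ ^ 2 ≤ L ^ 2 * ((M : ℝ) ^ d) ^ 2 := by
    intro j
    simp only [← mul_pow, ← norm_mul, ← torusFourier_shift]
    rw [torusFourier_parseval]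
    have h2 : ∀ q : Fin d → ZMod M,
        ‖(F (q + Pi.single j 1) : ℂ) - F q‖ ^ 2 ≤ L ^ 2 := by
      intro q
      rw [← Complex.ofReal_sub, Complex.norm_real]
      exact pow_le_pow_left₀ (norm_nonneg _) (hF q j) 2
    refine (mul_le_mul_of_nonneg_left (Finset.sum_le_sum fun q _ => h2 q)
      (by positivity)).trans (le_of_eq ?_)
    simp [ZMod.card]
    ring
  simp only [torusSymbol, Finset.sum_mul]
  rw [Finset.sum_comm]
  refine (Finset.sum_le_sum fun j _ => h1 j).trans (le_of_eq ?_)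
  simp
  ring

/-- Duality between Lipschitz functions and the discrete `H⁻¹` norm of a difference of two
empirical measures. -/
theorem sq_sum_sub_le_torus {ι : Type*} [Fintype ι] {F : (Fin d → ZMod M) → ℝ} {L : ℝ}
    (hF : ∀ q j, |F (q + Pi.single j 1) - F q| ≤ L) (u v : ι → Fin d → ZMod M) :
    (∑ i, F (u i) - ∑ i, F (v i)) ^ 2 ≤ d * L ^ 2 *
      ∑ k ∈ Finset.univ.erase (0 : Fin d → ZMod M),
        ‖∑ i, (torusChar k (u i) - torusChar k (v i))‖ ^ 2 / torusSymbol k := by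
  set Fh := torusFourier (fun q => (F q : ℂ)) with hFh
  set A : (Fin d → ZMod M) → ℂ := fun k => ∑ i, (torusChar k (u i) - torusChar k (v i)) with hA
  have hM : (0 : ℝ) < (M : ℝ) ^ d := by
    have : (0 : ℝ) < M := by exact_mod_cast Nat.pos_of_ne_zero (NeZero.ne M)
    positivity
  have h1 : (M : ℂ) ^ d * ((∑ i, F (u i) - ∑ i, F (v i) : ℝ) : ℂ) =
      ∑ k ∈ Finset.univ.erase (0 : Fin d → ZMod M), Fh k * A k := by
    -- The zero frequency drops out because both families have the same number of points.
    rw [Finset.sum_erase _ (by simp [hA, torusChar_zero_left])]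
    simp only [hA, Finset.mul_sum, mul_sub]
    rw [Finset.sum_comm]
    simp only [Finset.sum_sub_distrib, ← torusFourier_inversion, hFh]
    push_cast
    rw [mul_sub, Finset.mul_sum, Finset.mul_sum]
  have h2 : (M : ℝ) ^ d * |∑ i, F (u i) - ∑ i, F (v i)| ≤
      ∑ k ∈ Finset.univ.erase (0 : Fin d → ZMod M),
        (√(torusSymbol k) * ‖Fh k‖) * (‖A k‖ / √(torusSymbol k)) := by
    have h3 := congrArg norm h1
    rw [norm_mul, Complex.norm_real, norm_pow, Complex.norm_natCast, Real.norm_eq_abs] at h3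
    rw [h3]
    refine (norm_sum_le _ _).trans (Finset.sum_le_sum fun k hk => le_of_eq ?_)
    have := Real.sqrt_pos.2 (torusSymbol_pos (Finset.ne_of_mem_erase hk))
    rw [norm_mul]
    field_simp
  have h3 := (pow_le_pow_left₀ (by positivity) h2 2).trans
    (Finset.sum_mul_sq_le_sq_mul_sq _ _ _)
  have h4 : ∑ k ∈ Finset.univ.erase (0 : Fin d → ZMod M), (√(torusSymbol k) * ‖Fh k‖) ^ 2 ≤
      d * L ^ 2 * ((M : ℝ) ^ d) ^ 2 := by
    refine le_trans ?_ (sum_torusSymbol_mul_le hF)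
    have hs : ∀ k : Fin d → ZMod M, 0 ≤ torusSymbol k := fun k =>
      Finset.sum_nonneg fun _ _ => by positivity
    simp only [mul_pow, Real.sq_sqrt (hs _)]
    exact Finset.sum_le_sum_of_subset_of_nonneg (Finset.erase_subset _ _)
      fun k _ _ => mul_nonneg (hs k) (by positivity)
  have h5 : ∑ k ∈ Finset.univ.erase (0 : Fin d → ZMod M), (‖A k‖ / √(torusSymbol k)) ^ 2 =
      ∑ k ∈ Finset.univ.erase (0 : Fin d → ZMod M), ‖A k‖ ^ 2 / torusSymbol k := by
    refine Finset.sum_congr rfl fun k hk => ?_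
    rw [div_pow, Real.sq_sqrt (torusSymbol_pos (Finset.ne_of_mem_erase hk)).le]
  rw [h5, mul_pow, sq_abs] at h3
  have h6 := h3.trans (mul_le_mul_of_nonneg_right h4 (Finset.sum_nonneg fun k hk =>
    div_nonneg (by positivity) (torusSymbol_pos (Finset.ne_of_mem_erase hk)).le))
  refine le_of_mul_le_mul_left (h6.trans (le_of_eq ?_)) (pow_pos hM 2)
  ring

end DiscreteTorus

/-! ### Counting frequencies -/

section Frequencies

variable {d M : ℕ} [NeZero M]

theorem card_natAbs_valMinAbs_eq_le (r : ℕ) :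
    (Finset.univ.filter fun a : ZMod M => a.valMinAbs.natAbs = r).card ≤ 2 := by
  refine (Finset.card_le_card_of_injOn ZMod.valMinAbs (t := {(r : ℤ), -(r : ℤ)}) ?_
    ZMod.injective_valMinAbs.injOn).trans Finset.card_le_two
  intro a ha
  simp at ha ⊢
  omega

theorem card_natAbs_valMinAbs_le_le (r : ℕ) :
    (Finset.univ.filter fun a : ZMod M => a.valMinAbs.natAbs ≤ r).card ≤ 2 * r + 1 := by
  refine (Finset.card_le_card_of_injOn ZMod.valMinAbs (t := Finset.Icc (-(r : ℤ)) r) ?_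
    ZMod.injective_valMinAbs.injOn).trans ?_
  · intro a ha
    simp at ha ⊢
    omega
  · rw [Int.card_Icc]
    omega

/-- The frequencies whose `j`-th coordinate has absolute value `r`, and whose other coordinates
have absolute value at most `r`. -/
def frequencyShell (j : Fin d) (r : ℕ) : Finset (Fin d → ZMod M) :=
  Fintype.piFinset fun i => if i = j
    then Finset.univ.filter fun a : ZMod M => a.valMinAbs.natAbs = r
    else Finset.univ.filter fun a : ZMod M => a.valMinAbs.natAbs ≤ r

theorem card_frequencyShell_le (j : Fin d) (r : ℕ) :
    (frequencyShell (M := M) j r).card ≤ 2 * (2 * r + 1) ^ (d - 1) := by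
  rw [frequencyShell, Fintype.card_piFinset, ← Finset.mul_prod_erase _ _ (Finset.mem_univ j)]
  refine Nat.mul_le_mul (by simpa using card_natAbs_valMinAbs_eq_le r) ?_
  refine (Finset.prod_le_pow_card _ _ (2 * r + 1) fun i hi => ?_).trans (by simp)
  rw [if_neg (Finset.ne_of_mem_erase hi)]
  exact card_natAbs_valMinAbs_le_le r

/-- Take for `j` a coordinate of maximal absolute value. Shells may overlap, which is harmless for
upper bounds. -/
theorem exists_mem_frequencyShell {k : Fin d → ZMod M} (hk : k ≠ 0) :
    ∃ j, ∃ r ∈ Finset.Icc 1 (M / 2), k ∈ frequencyShell j r ∧ (k j).valMinAbs.natAbs = r := by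
  obtain ⟨i, hi⟩ := Function.ne_iff.1 hk
  obtain ⟨j, -, hj⟩ := Finset.exists_max_image Finset.univ
    (fun j => (k j).valMinAbs.natAbs) ⟨i, Finset.mem_univ i⟩
  have hi' : 0 < (k i).valMinAbs.natAbs :=
    Int.natAbs_pos.2 (by simpa [ZMod.valMinAbs_eq_zero] using hi)
  refine ⟨j, (k j).valMinAbs.natAbs, Finset.mem_Icc.2
    ⟨hi'.trans_le (hj i (Finset.mem_univ i)), ZMod.natAbs_valMinAbs_le _⟩, ?_, rfl⟩
  rw [frequencyShell, Fintype.mem_piFinset]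
  intro l
  split_ifs with h
  · subst h; simp
  · simpa using hj l (Finset.mem_univ l)

/-- About `r ^ (d - 1)` frequencies have size `r`, each contributing at most `M ^ 2 / (16 * r ^ 2)`.
The resulting sum is the source of the three dimensional regimes. -/
theorem sum_inv_torusSymbol_le :
    ∑ k ∈ Finset.univ.erase (0 : Fin d → ZMod M), (torusSymbol k)⁻¹ ≤
      (M : ℝ) ^ 2 / 8 * d * 3 ^ (d - 1) *
        ∑ r ∈ Finset.Icc 1 (M / 2), (r : ℝ) ^ (d - 1) / (r : ℝ) ^ 2 := by
  have hM : (0 : ℝ) < M := by exact_mod_cast Nat.pos_of_ne_zero (NeZero.ne M)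
  have h1 : ∀ k ∈ Finset.univ.erase (0 : Fin d → ZMod M), (torusSymbol k)⁻¹ ≤
      ∑ j, ∑ r ∈ Finset.Icc 1 (M / 2),
        if k ∈ frequencyShell j r then (M : ℝ) ^ 2 / (16 * (r : ℝ) ^ 2) else 0 := by
    intro k hk
    obtain ⟨j, r, hr, hkr, hjr⟩ := exists_mem_frequencyShell (Finset.ne_of_mem_erase hk)
    have hr0 : (0 : ℝ) < r := by exact_mod_cast (Finset.mem_Icc.1 hr).1
    have h2 : (torusSymbol k)⁻¹ ≤ (M : ℝ) ^ 2 / (16 * (r : ℝ) ^ 2) := by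
      have h3 := sq_le_torusSymbol k j
      rw [hjr] at h3
      exact (inv_anti₀ (by positivity) h3).trans (by rw [inv_div])
    refine h2.trans ?_
    have h4 : ∀ (j : Fin d) (r : ℕ), (0 : ℝ) ≤
        if k ∈ frequencyShell j r then (M : ℝ) ^ 2 / (16 * (r : ℝ) ^ 2) else 0 := by
      intro j r; split_ifs <;> positivity
    calc (M : ℝ) ^ 2 / (16 * (r : ℝ) ^ 2)
        = if k ∈ frequencyShell j r then (M : ℝ) ^ 2 / (16 * (r : ℝ) ^ 2) else 0 := by
          rw [if_pos hkr]
      _ ≤ ∑ r ∈ Finset.Icc 1 (M / 2),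
            if k ∈ frequencyShell j r then (M : ℝ) ^ 2 / (16 * (r : ℝ) ^ 2) else 0 :=
          Finset.single_le_sum (fun r _ => h4 j r) hr
      _ ≤ _ := Finset.single_le_sum (f := fun j => ∑ r ∈ Finset.Icc 1 (M / 2),
            if k ∈ frequencyShell j r then (M : ℝ) ^ 2 / (16 * (r : ℝ) ^ 2) else 0)
            (fun j _ => Finset.sum_nonneg fun r _ => h4 j r) (Finset.mem_univ j)
  refine (Finset.sum_le_sum h1).trans ?_
  rw [Finset.sum_comm]
  have h5 : ∀ j : Fin d, ∑ k ∈ Finset.univ.erase (0 : Fin d → ZMod M),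
      (∑ r ∈ Finset.Icc 1 (M / 2),
        if k ∈ frequencyShell j r then (M : ℝ) ^ 2 / (16 * (r : ℝ) ^ 2) else 0) ≤
      (M : ℝ) ^ 2 / 8 * 3 ^ (d - 1) *
        ∑ r ∈ Finset.Icc 1 (M / 2), (r : ℝ) ^ (d - 1) / (r : ℝ) ^ 2 := by
    intro j
    rw [Finset.sum_comm, Finset.mul_sum]
    refine Finset.sum_le_sum fun r hr => ?_
    have hr1 : (1 : ℝ) ≤ r := by exact_mod_cast (Finset.mem_Icc.1 hr).1
    have h6 : ((frequencyShell (M := M) j r).card : ℝ) ≤ 2 * (3 * (r : ℝ)) ^ (d - 1) := by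
      refine (Nat.cast_le.2 (card_frequencyShell_le j r)).trans ?_
      push_cast
      gcongr
      linarith
    calc _ ≤ ∑ k : Fin d → ZMod M,
          (if k ∈ frequencyShell j r then (M : ℝ) ^ 2 / (16 * (r : ℝ) ^ 2) else 0) :=
          Finset.sum_le_sum_of_subset_of_nonneg (Finset.erase_subset _ _) fun k _ _ => by
            split_ifs <;> positivity
      _ = (frequencyShell (M := M) j r).card * ((M : ℝ) ^ 2 / (16 * (r : ℝ) ^ 2)) := by
          simp
      _ ≤ 2 * (3 * (r : ℝ)) ^ (d - 1) * ((M : ℝ) ^ 2 / (16 * (r : ℝ) ^ 2)) := by gcongr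
      _ = _ := by rw [mul_pow]; field_simp; norm_num
  refine (Finset.sum_le_sum fun j _ => h5 j).trans (le_of_eq ?_)
  simp
  ring

end Frequencies

/-! ### Discretisation of the unit cube -/

section Grid

variable {d : ℕ}

/-- The cell of the cube, of side `1 / N`, that contains `x`. -/
noncomputable def gridIndex (N : ℕ) (x : EuclideanSpace ℝ (Fin d)) : Fin d → ZMod (2 * N) :=
  fun j => (⌊N * x j⌋₊ : ZMod (2 * N))

/-- The discrete torus `(ℤ/2N)^d` folded onto the grid of mesh `1 / N` in the cube. -/
noncomputable def gridPoint (N : ℕ) (q : Fin d → ZMod (2 * N)) : EuclideanSpace ℝ (Fin d) :=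
  WithLp.toLp 2 fun j => ((q j).valMinAbs.natAbs : ℝ) / N

/-- On the cube the floors lie in `0, …, N`, half the period, so folding leaves them unchanged and
only rounding moves the point. -/
theorem dist_gridPoint_gridIndex_le {N : ℕ} (hN : 1 ≤ N) {x : EuclideanSpace ℝ (Fin d)}
    (hx : x ∈ unitCube d) : dist x (gridPoint N (gridIndex N x)) ≤ √d / N := by
  have hN0 : (0 : ℝ) < N := by exact_mod_cast hN
  have h : ∀ j, dist (x j) (gridPoint N (gridIndex N x) j) ^ 2 ≤ (1 / (N : ℝ)) ^ 2 := by
    intro j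
    have h0 : 0 ≤ N * x j := mul_nonneg hN0.le (hx j).1
    have h1 : ⌊N * x j⌋₊ ≤ N := by
      refine Nat.floor_le_of_le ?_
      nlinarith [(hx j).2]
    have h2 : gridPoint N (gridIndex N x) j = (⌊N * x j⌋₊ : ℝ) / N := by
      simp only [gridPoint, gridIndex]
      rw [ZMod.valMinAbs_natCast_of_le_half (by omega)]
      simp
    rw [h2, Real.dist_eq]
    refine pow_le_pow_left₀ (abs_nonneg _) ?_ 2
    have h3 := Nat.floor_le h0
    have h4 := Nat.lt_floor_add_one (N * x j)
    have e : x j - (⌊N * x j⌋₊ : ℝ) / N = (N * x j - ⌊N * x j⌋₊) / N := by field_simp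
    rw [e, abs_div, abs_of_pos hN0, abs_of_nonneg (by linarith)]
    gcongr
    linarith
  rw [EuclideanSpace.dist_eq]
  refine (Real.sqrt_le_sqrt (Finset.sum_le_sum fun j _ => h j)).trans (le_of_eq ?_)
  simp only [Finset.sum_const, Finset.card_univ, Fintype.card_fin, nsmul_eq_mul]
  rw [Real.sqrt_mul (by positivity), Real.sqrt_sq (by positivity)]
  ring

theorem abs_natAbs_valMinAbs_add_one_sub_le {M : ℕ} [NeZero M] (a : ZMod M) :
    |((a + 1).valMinAbs.natAbs : ℝ) - a.valMinAbs.natAbs| ≤ 1 := by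
  have h1 : (1 : ZMod M).valMinAbs.natAbs ≤ 1 := by
    rw [ZMod.valMinAbs_natAbs_eq_min, ZMod.val_one_eq_one_mod]
    exact (min_le_left _ _).trans (Nat.mod_le 1 M)
  have h2 := ZMod.natAbs_valMinAbs_add_le a 1
  have h3 := ZMod.natAbs_valMinAbs_add_le (a + 1) (-1)
  rw [add_neg_cancel_right] at h3
  have h4 := ZMod.natAbs_valMinAbs_neg (1 : ZMod M)
  rw [abs_le]
  constructor
  · have : a.valMinAbs.natAbs ≤ (a + 1).valMinAbs.natAbs + 1 := by omega
    have : (a.valMinAbs.natAbs : ℝ) ≤ (a + 1).valMinAbs.natAbs + 1 := by exact_mod_cast this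
    linarith
  · have : (a + 1).valMinAbs.natAbs ≤ a.valMinAbs.natAbs + 1 := by omega
    have : ((a + 1).valMinAbs.natAbs : ℝ) ≤ a.valMinAbs.natAbs + 1 := by exact_mod_cast this
    linarith

/-- Folding by absolute value has no jump where the torus wraps around; this is the purpose of the
period `2 * N`. -/
theorem dist_gridPoint_add_single_le (N : ℕ) [NeZero (2 * N)] (q : Fin d → ZMod (2 * N)) (j : Fin d) :
    dist (gridPoint N (q + Pi.single j 1)) (gridPoint N q) ≤ 1 / N := by
  rw [EuclideanSpace.dist_eq]
  refine Real.sqrt_le_iff.2 ⟨by positivity, ?_⟩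
  rw [Finset.sum_eq_single j]
  · refine pow_le_pow_left₀ dist_nonneg ?_ 2
    simp only [gridPoint, Real.dist_eq, Pi.add_apply, Pi.single_eq_same]
    rw [← sub_div, abs_div, Nat.abs_cast]
    gcongr
    exact abs_natAbs_valMinAbs_add_one_sub_le _
  · intro i _ hi
    simp [gridPoint, hi]
  · simp

/-- The dual Kantorovich functional of two families in the cube is bounded by a discretisation
error and the discrete `H⁻¹` norm. -/
theorem sum_sub_sum_le_grid {ι : Type*} [Fintype ι] {N : ℕ} [NeZero (2 * N)] (hN : 1 ≤ N)
    {x y : ι → EuclideanSpace ℝ (Fin d)} (hx : ∀ i, x i ∈ unitCube d)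
    (hy : ∀ i, y i ∈ unitCube d) {f : EuclideanSpace ℝ (Fin d) → ℝ} (hf : LipschitzWith 1 f) :
    ∑ i, f (x i) - ∑ i, f (y i) ≤ √(8 * d * (Fintype.card ι : ℝ) ^ 2 / (N : ℝ) ^ 2 +
      2 * d / (N : ℝ) ^ 2 * ∑ k ∈ Finset.univ.erase (0 : Fin d → ZMod (2 * N)),
        ‖∑ i, (torusChar k (gridIndex N (x i)) - torusChar k (gridIndex N (y i)))‖ ^ 2
          / torusSymbol k) := by
  have hLip : ∀ a b, |f a - f b| ≤ dist a b := fun a b => by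
    simpa [Real.dist_eq] using hf.dist_le_mul a b
  have h1 := sq_sum_sub_le_torus (F := fun q => f (gridPoint N q)) (L := 1 / N)
    (fun q j => (hLip _ _).trans (dist_gridPoint_add_single_le N q j))
    (fun i => gridIndex N (x i)) (fun i => gridIndex N (y i))
  set W := ∑ k ∈ Finset.univ.erase (0 : Fin d → ZMod (2 * N)),
    ‖∑ i, (torusChar k (gridIndex N (x i)) - torusChar k (gridIndex N (y i)))‖ ^ 2
      / torusSymbol k
  set R := ∑ i, f (gridPoint N (gridIndex N (x i))) - ∑ i, f (gridPoint N (gridIndex N (y i)))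
  have h2 : ∀ z : ι → EuclideanSpace ℝ (Fin d), (∀ i, z i ∈ unitCube d) →
      |∑ i, f (z i) - ∑ i, f (gridPoint N (gridIndex N (z i)))| ≤
        Fintype.card ι * (√d / N) := by
    intro z hz
    rw [← Finset.sum_sub_distrib]
    refine (Finset.abs_sum_le_sum_abs _ _).trans ((Finset.sum_le_sum fun i _ =>
      (hLip _ _).trans (dist_gridPoint_gridIndex_le hN (hz i))).trans (le_of_eq ?_))
    simp
  have h3 := abs_le.1 (h2 x hx)
  have h4 := abs_le.1 (h2 y hy)
  refine le_trans (b := 2 * (Fintype.card ι * (√d / N)) + |R|) ?_ (Real.le_sqrt_of_sq_le ?_)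
  · have := le_abs_self R
    simp only [R] at this ⊢
    linarith
  · have h5 : (√(d : ℝ)) ^ 2 = d := Real.sq_sqrt (by positivity)
    -- Rounding both families costs `2 * card * √d / N`; `(a + b) ^ 2 ≤ 2 * a ^ 2 + 2 * b ^ 2`
    -- separates it from `R`.
    have h6 : (2 * (Fintype.card ι * (√d / N)) + |R|) ^ 2 ≤
        2 * (2 * (Fintype.card ι * (√d / N))) ^ 2 + 2 * R ^ 2 := by
      rw [← sq_abs R]
      nlinarith [sq_nonneg (2 * (Fintype.card ι * (√d / N)) - |R|)]
    have h7 : 2 * (2 * (Fintype.card ι * (√d / N))) ^ 2 =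
        8 * d * (Fintype.card ι : ℝ) ^ 2 / (N : ℝ) ^ 2 := by
      rw [mul_pow, mul_pow, div_pow, h5]; ring
    have h8 : 2 * (d * (1 / (N : ℝ)) ^ 2 * W) = 2 * d / (N : ℝ) ^ 2 * W := by ring
    linarith

theorem measurable_torusChar_gridIndex (N : ℕ) [NeZero (2 * N)] (k : Fin d → ZMod (2 * N)) :
    Measurable fun x : EuclideanSpace ℝ (Fin d) => torusChar k (gridIndex N x) := by
  have h1 : Measurable fun x : EuclideanSpace ℝ (Fin d) => fun j => ⌊N * x j⌋₊ :=
    measurable_pi_lambda _ fun j => Nat.measurable_floor.comp (by fun_prop)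
  have h2 : Measurable fun m : Fin d → ℕ => torusChar k fun j => (m j : ZMod (2 * N)) :=
    Measurable.of_discrete
  exact h2.comp h1

end Grid

/-! ### Second moments of empirical differences -/

theorem norm_sq_sum_sub_eq {E ι : Type*} [Fintype ι] (g : E → ℂ) (x y : ι → E) :
    ‖∑ i, (g (x i) - g (y i))‖ ^ 2 = (∑ i, ((g (x i)).re - (g (y i)).re)) ^ 2 +
      (∑ i, ((g (x i)).im - (g (y i)).im)) ^ 2 := by
  rw [← Complex.normSq_eq_norm_sq, Complex.normSq_apply]
  simp only [Complex.re_sum, Complex.im_sum, sq, Complex.sub_re, Complex.sub_im]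

section SecondMoment

variable {Ω E ι : Type*} [MeasurableSpace Ω] [MeasurableSpace E] [Fintype ι] {μ : Measure Ω}
  [IsProbabilityMeasure μ] {X Y : ι → Ω → E}

/-- Second moment of the difference of the empirical sums of a bounded real observable. -/
theorem integral_sq_sum_sub_le (hX : ∀ i, Measurable (X i)) (hY : ∀ i, Measurable (Y i))
    (hind : iIndepFun (Sum.elim X Y) μ) (hlaw : ∀ i, μ.map (X i) = μ.map (Y i)) {g : E → ℝ}
    (hg : Measurable g) (hg1 : ∀ z, |g z| ≤ 1) :
    ∫ ω, (∑ i, (g (X i ω) - g (Y i ω))) ^ 2 ∂μ ≤ 2 * Fintype.card ι := by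
  -- Signed observables make the difference one sum of `2 * card ι` independent terms. Its mean
  -- vanishes by equality of laws, so its second moment is a sum of variances, each at most `1`.
  let h : ι ⊕ ι → E → ℝ := Sum.elim (fun _ => g) (fun _ z => -g z)
  let Z : ι ⊕ ι → Ω → ℝ := fun s ω => h s (Sum.elim X Y s ω)
  have hh : ∀ s, Measurable (h s) := by rintro (i | i); exacts [hg, hg.neg]
  have hh1 : ∀ s z, |h s z| ≤ 1 := by
    rintro (i | i) z
    · exact hg1 z
    · simpa [h] using hg1 z
  have hXY : ∀ s, Measurable (Sum.elim X Y s) := by rintro (i | i); exacts [hX i, hY i]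
  have hZ : ∀ s, Measurable (Z s) := fun s => (hh s).comp (hXY s)
  have hL : ∀ s, MemLp (Z s) 2 μ := fun s =>
    MemLp.of_bound (hZ s).aestronglyMeasurable 1 (ae_of_all _ fun ω => hh1 s _)
  have hindZ : iIndepFun Z μ := hind.comp h hh
  have hsum : (∑ s, Z s) = fun ω => ∑ i, (g (X i ω) - g (Y i ω)) := by
    ext ω
    simp [Z, h, Fintype.sum_sum_type, sub_eq_add_neg, Finset.sum_add_distrib]
  have hint : ∀ s, Integrable (Z s) μ := fun s => (hL s).integrable (by norm_num)
  have hmean : μ[∑ s, Z s] = 0 := by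
    have e : μ[∑ s, Z s] = ∑ s, μ[Z s] := by
      simp only [Finset.sum_apply]
      exact integral_finsetSum _ fun s _ => hint s
    rw [e, Fintype.sum_sum_type, ← Finset.sum_add_distrib]
    refine Finset.sum_eq_zero fun i _ => ?_
    have e1 : ∫ ω, g (X i ω) ∂μ = ∫ ω, g (Y i ω) ∂μ := by
      rw [← integral_map (hX i).aemeasurable hg.aestronglyMeasurable, hlaw i,
        integral_map (hY i).aemeasurable hg.aestronglyMeasurable]
    simp [Z, h, integral_neg, e1]
  have hmeas : Measurable (∑ s, Z s) := by
    simpa only [← Finset.sum_apply] using Finset.measurable_fun_sum Finset.univ fun s _ => hZ s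
  have hvar := variance_of_integral_eq_zero hmeas.aemeasurable hmean
  rw [IndepFun.variance_sum (fun s _ => hL s) fun s _ t _ hst => hindZ.indepFun hst, hsum]
    at hvar
  rw [← hvar]
  have hv : ∀ s, variance (Z s) μ ≤ 1 := by
    intro s
    refine (variance_le_expectation_sq (hL s).1).trans ?_
    have : ∫ ω, (Z s ^ 2) ω ∂μ ≤ ∫ ω, (1 : ℝ) ∂μ := by
      refine integral_mono (hL s).integrable_sq (integrable_const _) fun ω => ?_
      simpa using sq_le_one_iff_abs_le_one _ |>.2 (hh1 s (Sum.elim X Y s ω))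
    simpa using this
  refine (Finset.sum_le_sum fun s _ => hv s).trans (le_of_eq ?_)
  simp [Fintype.card_sum]
  ring

theorem integrable_sq_sum_sub (hX : ∀ i, Measurable (X i)) (hY : ∀ i, Measurable (Y i))
    {g : E → ℝ} (hg : Measurable g) (hg1 : ∀ z, |g z| ≤ 1) :
    Integrable (fun ω => (∑ i, (g (X i ω) - g (Y i ω))) ^ 2) μ := by
  have hm : Measurable fun ω => ∑ i, (g (X i ω) - g (Y i ω)) :=
    Finset.measurable_fun_sum _ fun i _ => (hg.comp (hX i)).sub (hg.comp (hY i))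
  refine MemLp.integrable_sq (MemLp.of_bound hm.aestronglyMeasurable (∑ _i : ι, (2 : ℝ))
    (ae_of_all _ fun ω => ?_))
  refine (norm_sum_le _ _).trans (Finset.sum_le_sum fun i _ => ?_)
  have h1 := hg1 (X i ω)
  have h2 := hg1 (Y i ω)
  rw [Real.norm_eq_abs]
  exact (abs_sub _ _).trans (by linarith)

theorem integral_norm_sq_sum_sub_le (hX : ∀ i, Measurable (X i)) (hY : ∀ i, Measurable (Y i))
    (hind : iIndepFun (Sum.elim X Y) μ) (hlaw : ∀ i, μ.map (X i) = μ.map (Y i)) {g : E → ℂ}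
    (hg : Measurable g) (hg1 : ∀ z, ‖g z‖ ≤ 1) :
    Integrable (fun ω => ‖∑ i, (g (X i ω) - g (Y i ω))‖ ^ 2) μ ∧
      ∫ ω, ‖∑ i, (g (X i ω) - g (Y i ω))‖ ^ 2 ∂μ ≤ 4 * Fintype.card ι := by
  have hre : Measurable fun z => (g z).re := Complex.measurable_re.comp hg
  have him : Measurable fun z => (g z).im := Complex.measurable_im.comp hg
  have hre1 : ∀ z, |(g z).re| ≤ 1 := fun z => (Complex.abs_re_le_norm _).trans (hg1 z)
  have him1 : ∀ z, |(g z).im| ≤ 1 := fun z => (Complex.abs_im_le_norm _).trans (hg1 z)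
  have i1 := integrable_sq_sum_sub (μ := μ) hX hY hre hre1
  have i2 := integrable_sq_sum_sub (μ := μ) hX hY him him1
  have h1 := integral_sq_sum_sub_le hX hY hind hlaw hre hre1
  have h2 := integral_sq_sum_sub_le hX hY hind hlaw him him1
  simp only [norm_sq_sum_sub_eq]
  constructor
  · exact i1.add i2
  · rw [integral_add i1 i2]
    linarith

end SecondMoment

/-! ### Uniform points in the cube -/

theorem measurableSet_unitCube (d : ℕ) : MeasurableSet (unitCube d) := by
  have : unitCube d = ⋂ i, (fun x : EuclideanSpace ℝ (Fin d) => x i) ⁻¹' Set.Icc 0 1 := by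
    ext x; simp [unitCube]
  rw [this]
  exact MeasurableSet.iInter fun i => (by fun_prop : Measurable
    fun x : EuclideanSpace ℝ (Fin d) => x i) measurableSet_Icc

theorem ae_mem_unitCube {d : ℕ} {Ω : Type*} [MeasurableSpace Ω] {μ : Measure Ω}
    {X : Ω → EuclideanSpace ℝ (Fin d)} (hX : Measurable X)
    (hu : pdf.IsUniform X (unitCube d) μ volume) : ∀ᵐ ω ∂μ, X ω ∈ unitCube d := by
  refine ae_of_ae_map hX.aemeasurable ?_
  rw [hu]
  exact ae_cond_mem (measurableSet_unitCube d)

/-- In expectation, the square of the dual Kantorovich functional of `n` red and `n` blue uniform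
points in the cube is controlled by a sum over frequencies up to the discretisation scale `N`. -/
theorem exists_dual_bound_uniform {d n N : ℕ} (hN : 1 ≤ N) {Ω : Type*} [MeasurableSpace Ω]
    {μ : Measure Ω} [IsProbabilityMeasure μ] {X Y : Fin n → Ω → EuclideanSpace ℝ (Fin d)}
    (hX : ∀ i, Measurable (X i)) (hY : ∀ i, Measurable (Y i))
    (hind : iIndepFun (Sum.elim X Y) μ)
    (hXu : ∀ i, pdf.IsUniform (X i) (unitCube d) μ volume)
    (hYu : ∀ i, pdf.IsUniform (Y i) (unitCube d) μ volume) :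
    ∃ V : Ω → ℝ, (∀ ω, 0 ≤ V ω) ∧ Integrable V μ ∧
      ∫ ω, V ω ∂μ ≤ 8 * d * (n : ℝ) ^ 2 / (N : ℝ) ^ 2 + 4 * (d : ℝ) ^ 2 * 3 ^ (d - 1) * n *
        ∑ r ∈ Finset.Icc 1 N, (r : ℝ) ^ (d - 1) / (r : ℝ) ^ 2 ∧
      ∀ᵐ ω ∂μ, ∀ f : EuclideanSpace ℝ (Fin d) → ℝ, LipschitzWith 1 f →
        ∑ i, f (X i ω) - ∑ i, f (Y i ω) ≤ √(V ω) := by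
  have : NeZero (2 * N) := ⟨by omega⟩
  have hN0 : (0 : ℝ) < N := by exact_mod_cast hN
  have hlaw : ∀ i, μ.map (X i) = μ.map (Y i) := fun i => by rw [hXu i, hYu i]
  have hk : ∀ k : Fin d → ZMod (2 * N), _ := fun k =>
    integral_norm_sq_sum_sub_le hX hY hind hlaw (measurable_torusChar_gridIndex N k)
      (fun z => (norm_torusChar k _).le)
  have hpos : ∀ k ∈ Finset.univ.erase (0 : Fin d → ZMod (2 * N)), 0 < torusSymbol k :=
    fun k hk => torusSymbol_pos (Finset.ne_of_mem_erase hk)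
  have hWint : Integrable (fun ω => ∑ k ∈ Finset.univ.erase (0 : Fin d → ZMod (2 * N)),
      ‖∑ i, (torusChar k (gridIndex N (X i ω)) - torusChar k (gridIndex N (Y i ω)))‖ ^ 2
        / torusSymbol k) μ :=
    integrable_finsetSum _ fun k _ => (hk k).1.div_const _
  -- This explicit majorant is integrable, which avoids measurability of a supremum over all
  -- Lipschitz functions.
  refine ⟨fun ω => 8 * d * (n : ℝ) ^ 2 / (N : ℝ) ^ 2 +
    2 * d / (N : ℝ) ^ 2 * ∑ k ∈ Finset.univ.erase (0 : Fin d → ZMod (2 * N)),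
      ‖∑ i, (torusChar k (gridIndex N (X i ω)) - torusChar k (gridIndex N (Y i ω)))‖ ^ 2
        / torusSymbol k, fun ω => ?_, (integrable_const _).add (hWint.const_mul _), ?_, ?_⟩
  · exact add_nonneg (by positivity) (mul_nonneg (by positivity)
      (Finset.sum_nonneg fun k hk => div_nonneg (by positivity) (hpos k hk).le))
  · rw [integral_add (integrable_const _) (hWint.const_mul _), integral_const_mul,
      integral_finsetSum _ fun k _ => (hk k).1.div_const _]
    have h1 : ∑ k ∈ Finset.univ.erase (0 : Fin d → ZMod (2 * N)),
        ∫ ω, ‖∑ i, (torusChar k (gridIndex N (X i ω)) -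
          torusChar k (gridIndex N (Y i ω)))‖ ^ 2 / torusSymbol k ∂μ ≤
        4 * n * ∑ k ∈ Finset.univ.erase (0 : Fin d → ZMod (2 * N)), (torusSymbol k)⁻¹ := by
      rw [Finset.mul_sum]
      refine Finset.sum_le_sum fun k hk' => ?_
      rw [integral_div, div_eq_mul_inv]
      refine mul_le_mul_of_nonneg_right ?_ (inv_nonneg.2 (hpos k hk').le)
      simpa using (hk k).2
    have h2 := sum_inv_torusSymbol_le (d := d) (M := 2 * N)
    rw [Nat.mul_div_cancel_left N (by norm_num)] at h2
    set H := ∑ r ∈ Finset.Icc 1 N, (r : ℝ) ^ (d - 1) / (r : ℝ) ^ 2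
    have h3 := h1.trans (mul_le_mul_of_nonneg_left h2 (by positivity : (0 : ℝ) ≤ 4 * n))
    have h4 := mul_le_mul_of_nonneg_left h3 (by positivity : (0 : ℝ) ≤ 2 * d / (N : ℝ) ^ 2)
    simp only [integral_const, probReal_univ, one_smul]
    refine add_le_add_right (h4.trans (le_of_eq ?_)) _
    push_cast
    field_simp
    ring
  · filter_upwards [ae_all_iff.2 fun i => ae_mem_unitCube (hX i) (hXu i),
      ae_all_iff.2 fun i => ae_mem_unitCube (hY i) (hYu i)] with ω h1 h2 f hf
    simpa using sum_sub_sum_le_grid hN h1 h2 hf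

/-- If the dual Kantorovich functional has second moment at most `B`, the expected greedy cost is at
most a constant times `n ^ (1 - p) * B ^ (p / 2)`. -/
theorem integral_matchingCost_le {d n : ℕ} {p : ℝ} (hp0 : 0 < p) (hp : p < 1 / 2) (hn : 1 ≤ n)
    {Ω : Type*} [MeasurableSpace Ω] {μ : Measure Ω} [IsProbabilityMeasure μ]
    {X Y : Fin n → Ω → EuclideanSpace ℝ (Fin d)}
    (hX : ∀ i, Measurable (X i)) (hY : ∀ i, Measurable (Y i))
    {π : Ω → Equiv.Perm (Fin n)} (hπm : ∀ σ, MeasurableSet {ω | π ω = σ})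
    (hπ : ∀ᵐ ω ∂μ, IsGreedyMatching p (fun i => X i ω) (fun i => Y i ω) (π ω))
    {V : Ω → ℝ} (hV0 : ∀ ω, 0 ≤ V ω) (hVint : Integrable V μ) {B : ℝ} (hB : 0 < B)
    (hVB : ∫ ω, V ω ∂μ ≤ B)
    (hV : ∀ᵐ ω ∂μ, ∀ f : EuclideanSpace ℝ (Fin d) → ℝ, LipschitzWith 1 f →
        ∑ i, f (X i ω) - ∑ i, f (Y i ω) ≤ √(V ω)) :
    Integrable (fun ω => matchingCost p (fun i => X i ω) (fun i => Y i ω) (π ω)) μ ∧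
      ∫ ω, matchingCost p (fun i => X i ω) (fun i => Y i ω) (π ω) ∂μ ≤
        2 * (2 ^ p / (1 - 2 * p)) * (n : ℝ) ^ (1 - p) * B ^ (p / 2) := by
  have h12 : 0 < 1 - 2 * p := by linarith
  set K := 2 ^ p / (1 - 2 * p) * (n : ℝ) ^ (1 - p) * B ^ (p / 2) with hK
  have hK0 : 0 ≤ K := by positivity
  -- The bound `u ^ (p / 2) ≤ 1 + u` at `u = V ω / B` stands in for Jensen's inequality; its
  -- expectation is at most `2`.
  have hbound : ∀ᵐ ω ∂μ, matchingCost p (fun i => X i ω) (fun i => Y i ω) (π ω) ≤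
      K * (1 + V ω / B) := by
    filter_upwards [hπ, hV] with ω h1 h2
    refine (matchingCost_le_of_isGreedyMatching hp0 hp hn h1 h2).trans ?_
    rw [hK, mul_assoc _ (B ^ (p / 2))]
    refine mul_le_mul_of_nonneg_left ?_ (by positivity)
    have hVB0 : 0 ≤ V ω / B := div_nonneg (hV0 ω) hB.le
    have e : √(V ω) ^ p = B ^ (p / 2) * (V ω / B) ^ (p / 2) := by
      rw [← Real.mul_rpow hB.le hVB0, mul_div_cancel₀ _ hB.ne', Real.sqrt_eq_rpow,
        ← Real.rpow_mul (hV0 ω)]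
      ring_nf
    rw [e]
    refine mul_le_mul_of_nonneg_left ?_ (by positivity)
    calc (V ω / B) ^ (p / 2) ≤ (1 + V ω / B) ^ (p / 2) :=
          Real.rpow_le_rpow hVB0 (by linarith) (by linarith)
      _ ≤ (1 + V ω / B) ^ (1 : ℝ) :=
          Real.rpow_le_rpow_of_exponent_le (by linarith) (by linarith)
      _ = _ := Real.rpow_one _
  have hmeas : Measurable fun ω => matchingCost p (fun i => X i ω) (fun i => Y i ω) (π ω) := by
    -- The matching takes finitely many values, so the cost splits over the measurable events `π ω =
    -- σ`.
    have e : (fun ω => matchingCost p (fun i => X i ω) (fun i => Y i ω) (π ω)) = fun ω =>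
        ∑ σ : Equiv.Perm (Fin n), {ω | π ω = σ}.indicator
          (fun ω => matchingCost p (fun i => X i ω) (fun i => Y i ω) σ) ω := by
      ext ω
      simp [Set.indicator_apply]
    rw [e]
    refine Finset.measurable_fun_sum _ fun σ _ => Measurable.indicator ?_ (hπm σ)
    exact Finset.measurable_fun_sum _ fun i _ => ((hX i).sub (hY _)).norm.pow_const p
  have hint : Integrable (fun ω => K * (1 + V ω / B)) μ :=
    ((integrable_const _).add (hVint.div_const _)).const_mul _
  have hcost : Integrable (fun ω => matchingCost p (fun i => X i ω) (fun i => Y i ω) (π ω)) μ := by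
    refine hint.mono' hmeas.aestronglyMeasurable ?_
    filter_upwards [hbound] with ω h
    rwa [Real.norm_of_nonneg]
    exact Finset.sum_nonneg fun i _ => by positivity
  refine ⟨hcost, (integral_mono_ae hcost hint hbound).trans ?_⟩
  rw [integral_const_mul, integral_add (integrable_const _) (hVint.div_const _), integral_div]
  simp only [integral_const, probReal_univ, one_smul]
  have : (∫ ω, V ω ∂μ) / B ≤ 1 := (div_le_one hB).2 hVB
  calc K * (1 + (∫ ω, V ω ∂μ) / B) ≤ K * 2 := by gcongr; linarith
    _ = _ := by rw [hK]; ring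

/-! ### Choice of the discretisation scale -/

theorem sum_Icc_inv_sq_le_two (N : ℕ) : ∑ r ∈ Finset.Icc 1 N, ((r : ℝ) ^ 2)⁻¹ ≤ 2 := by
  rcases Nat.eq_zero_or_pos N with rfl | hN
  · simp
  have h : ∑ r ∈ Finset.Icc 1 N, ((r : ℝ) ^ 2)⁻¹ ≤ 2 - (N : ℝ)⁻¹ := by
    induction N, hN using Nat.le_induction with
    | base => norm_num
    | succ m hm ih =>
      rw [Finset.sum_Icc_succ_top (by omega)]
      have hm0 : (0 : ℝ) < m := by exact_mod_cast hm
      have : (((m : ℝ) + 1) ^ 2)⁻¹ ≤ (m : ℝ)⁻¹ - ((m : ℝ) + 1)⁻¹ := by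
        rw [inv_sub_inv hm0.ne' (by positivity), add_sub_cancel_left, one_div]
        exact inv_anti₀ (by positivity) (by nlinarith)
      push_cast
      linarith
  have : (0 : ℝ) ≤ (N : ℝ)⁻¹ := by positivity
  linarith

/-- The order of magnitude of the second moment of the transport cost between `n` red and `n` blue
uniform points in dimension `d`. -/
noncomputable def transportRate (d n : ℕ) : ℝ :=
  if d = 1 then n else if d = 2 then n * Real.log n else (n : ℝ) ^ (2 - 2 / (d : ℝ))

theorem transportRate_pos {d n : ℕ} (hn : 1 ≤ n) (hn2 : d = 2 → 2 ≤ n) :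
    0 < transportRate d n := by
  have hn0 : (0 : ℝ) < n := by exact_mod_cast hn
  rw [transportRate]
  split_ifs with h1 h2
  · exact hn0
  · exact mul_pos hn0 (Real.log_pos (by exact_mod_cast hn2 h2))
  · positivity

/-- For `d ≤ 2` the frequency sum grows at most logarithmically, so the fine mesh `N = n` is
affordable. For `d ≥ 3` both terms have order `n ^ (2 - 2 / d)` when `N` is about `n ^ (1 / d)`. -/
theorem exists_scale (d : ℕ) (hd : 1 ≤ d) : ∃ C : ℝ, 0 < C ∧ ∀ n : ℕ, 1 ≤ n → (d = 2 → 2 ≤ n) →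
    ∃ N : ℕ, 1 ≤ N ∧
      8 * d * (n : ℝ) ^ 2 / (N : ℝ) ^ 2 + 4 * (d : ℝ) ^ 2 * 3 ^ (d - 1) * n *
        ∑ r ∈ Finset.Icc 1 N, (r : ℝ) ^ (d - 1) / (r : ℝ) ^ 2 ≤ C * transportRate d n := by
  rcases (by omega : d = 1 ∨ d = 2 ∨ 3 ≤ d) with rfl | rfl | h3
  · refine ⟨16, by norm_num, fun n hn _ => ⟨n, hn, ?_⟩⟩
    have hn1 : (1 : ℝ) ≤ n := by exact_mod_cast hn
    have h := sum_Icc_inv_sq_le_two n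
    have e : 8 * ((1 : ℕ) : ℝ) * (n : ℝ) ^ 2 / (n : ℝ) ^ 2 = 8 := by
      field_simp; norm_num
    rw [e]
    simp only [transportRate, if_true, Nat.sub_self, pow_zero, one_div, Nat.cast_one]
    nlinarith
  -- As `log n ≥ 1 / 2` and `n ≥ 2`, `1 + log n ≤ 3 * log n` and `1 ≤ n * log n`; thus `160 = 16 +
  -- 48 * 3`.
  · refine ⟨160, by norm_num, fun n hn hn2 => ⟨n, hn, ?_⟩⟩
    have hn2' : (2 : ℝ) ≤ n := by exact_mod_cast hn2 rfl
    have hlog : 1 / 2 ≤ Real.log n :=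
      (by linarith [Real.log_two_gt_d9] : (1 : ℝ) / 2 ≤ Real.log 2).trans
        (Real.log_le_log (by norm_num) hn2')
    have e : 8 * ((2 : ℕ) : ℝ) * (n : ℝ) ^ 2 / (n : ℝ) ^ 2 = 16 := by
      field_simp; norm_num
    have h : ∑ r ∈ Finset.Icc 1 n, (r : ℝ) ^ (2 - 1) / (r : ℝ) ^ 2 ≤ 1 + Real.log n := by
      refine le_trans (le_of_eq ?_) (harmonic_le_one_add_log n)
      rw [harmonic_eq_sum_Icc]
      push_cast
      refine Finset.sum_congr rfl fun r hr => ?_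
      have : (0 : ℝ) < r := by exact_mod_cast (Finset.mem_Icc.1 hr).1
      field_simp
    rw [e]
    simp only [transportRate, if_true, if_neg (by norm_num : ¬ (2 : ℕ) = 1)]
    have h4 := mul_le_mul_of_nonneg_left h (by positivity : (0 : ℝ) ≤ 48 * n)
    norm_num at h4 ⊢
    nlinarith
  · have hd0 : (0 : ℝ) < d := by exact_mod_cast hd
    -- The factor `2 ^ (d - 2)` pays for rounding `t = n ^ (1 / d)` up to an integer, which is at
    -- most `2 * t`.
    refine ⟨8 * d + 4 * (d : ℝ) ^ 2 * 3 ^ (d - 1) * 2 ^ (d - 2), by positivity, fun n hn _ => ?_⟩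
    have hn1 : (1 : ℝ) ≤ n := by exact_mod_cast hn
    have hn0 : (0 : ℝ) < n := by linarith
    set t : ℝ := (n : ℝ) ^ (1 / (d : ℝ)) with ht
    have ht1 : 1 ≤ t := Real.one_le_rpow hn1 (by positivity)
    have ht0 : 0 < t := by linarith
    have htd : t ^ d = n := by
      rw [ht, ← Real.rpow_natCast, ← Real.rpow_mul hn0.le, one_div_mul_cancel hd0.ne',
        Real.rpow_one]
    have hrate : transportRate d n = (n : ℝ) ^ 2 / t ^ 2 := by
      have e : t ^ 2 = (n : ℝ) ^ (2 / (d : ℝ)) := by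
        rw [ht, ← Real.rpow_two, ← Real.rpow_mul hn0.le]
        ring_nf
      rw [transportRate, if_neg (by omega), if_neg (by omega), Real.rpow_sub hn0, Real.rpow_two, e]
    have hNt : t ≤ ⌈t⌉₊ := Nat.le_ceil t
    have hNt2 : (⌈t⌉₊ : ℝ) ≤ 2 * t := by linarith [Nat.ceil_lt_add_one ht0.le]
    refine ⟨⌈t⌉₊, Nat.one_le_ceil_iff.2 ht0, ?_⟩
    set N := ⌈t⌉₊
    have h1 : 8 * d * (n : ℝ) ^ 2 / (N : ℝ) ^ 2 ≤ 8 * d * ((n : ℝ) ^ 2 / t ^ 2) := by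
      rw [mul_div_assoc]
      gcongr
    have h2 : ∑ r ∈ Finset.Icc 1 N, (r : ℝ) ^ (d - 1) / (r : ℝ) ^ 2 ≤ (2 * t) ^ (d - 2) := by
      have h4 : ∀ r ∈ Finset.Icc 1 N, (r : ℝ) ^ (d - 1) / (r : ℝ) ^ 2 ≤ (N : ℝ) ^ (d - 3) := by
        intro r hr
        have hr0 : (0 : ℝ) < r := by exact_mod_cast (Finset.mem_Icc.1 hr).1
        have hrN : (r : ℝ) ≤ N := by exact_mod_cast (Finset.mem_Icc.1 hr).2
        have e : d - 1 = (d - 3) + 2 := by omega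
        rw [e, pow_add, mul_div_cancel_right₀ _ (by positivity)]
        exact pow_le_pow_left₀ hr0.le hrN _
      refine (Finset.sum_le_sum h4).trans ?_
      have e : d - 2 = (d - 3) + 1 := by omega
      simp only [Finset.sum_const, Nat.card_Icc, Nat.add_sub_cancel, nsmul_eq_mul]
      rw [mul_comm, ← pow_succ, ← e]
      exact pow_le_pow_left₀ (by positivity) hNt2 _
    have e5 : (n : ℝ) * t ^ (d - 2) = (n : ℝ) ^ 2 / t ^ 2 := by
      have e6 : t ^ d = t ^ (d - 2) * t ^ 2 := by rw [← pow_add]; congr 1; omega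
      rw [eq_div_iff (by positivity), mul_assoc, ← e6, htd, sq]
    rw [hrate, add_mul]
    refine add_le_add h1 ?_
    calc _ ≤ 4 * (d : ℝ) ^ 2 * 3 ^ (d - 1) * n * (2 * t) ^ (d - 2) := by gcongr
      _ = 4 * (d : ℝ) ^ 2 * 3 ^ (d - 1) * 2 ^ (d - 2) * (n * t ^ (d - 2)) := by
        rw [mul_pow]; ring
      _ = _ := by rw [e5]

theorem rpow_mul_transportRate_rpow {d n : ℕ} (hn : 1 ≤ n) (p : ℝ) :
    (n : ℝ) ^ (1 - p) * transportRate d n ^ (p / 2) =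
      if d = 1 then (n : ℝ) ^ (1 - p / 2)
      else if d = 2 then (n : ℝ) ^ (1 - p / 2) * (Real.log n) ^ (p / 2)
      else (n : ℝ) ^ (1 - p / d) := by
  have hn0 : (0 : ℝ) < n := by exact_mod_cast hn
  rw [transportRate]
  split_ifs with h1 h2
  · rw [← Real.rpow_add hn0]; ring_nf
  · rw [Real.mul_rpow hn0.le (Real.log_natCast_nonneg n), ← mul_assoc, ← Real.rpow_add hn0]
    ring_nf
  · rw [← Real.rpow_mul hn0.le, ← Real.rpow_add hn0]
    ring_nf

theorem corollary1 (p : ℝ) (hp0 : 0 < p) (hp : p < 1 / 2) (d : ℕ) (hd : 1 ≤ d) :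
    ∃ c : ℝ, 0 < c ∧
      ∀ (n : ℕ), 1 ≤ n → (d = 2 → 2 ≤ n) →
      ∀ {Ω : Type*} [MeasurableSpace Ω] (μ : Measure Ω) [IsProbabilityMeasure μ]
        (X Y : Fin n → Ω → EuclideanSpace ℝ (Fin d)),
        (∀ i, Measurable (X i)) → (∀ i, Measurable (Y i)) →
        -- all `2 n` points are independent and uniformly distributed on the cube
        iIndepFun (Sum.elim X Y) μ →
        (∀ i, pdf.IsUniform (X i) (unitCube d) μ volume) →
        (∀ i, pdf.IsUniform (Y i) (unitCube d) μ volume) →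
        -- `π` is the (random) matching produced by the greedy algorithm
        ∀ π : Ω → Equiv.Perm (Fin n),
        (∀ σ, MeasurableSet {ω | π ω = σ}) →
        (∀ᵐ ω ∂μ, IsGreedyMatching p (fun i => X i ω) (fun i => Y i ω) (π ω)) →
        Integrable (fun ω => matchingCost p (fun i => X i ω) (fun i => Y i ω) (π ω)) μ ∧
        ∫ ω, matchingCost p (fun i => X i ω) (fun i => Y i ω) (π ω) ∂μ ≤
          c * (if d = 1 then (n : ℝ) ^ (1 - p / 2)
            else if d = 2 then (n : ℝ) ^ (1 - p / 2) * (Real.log n) ^ (p / 2)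
            else (n : ℝ) ^ (1 - p / d)) := by
  obtain ⟨C, hC, hscale⟩ := exists_scale d hd
  have h12 : 0 < 1 - 2 * p := by linarith
  refine ⟨2 * (2 ^ p / (1 - 2 * p)) * C ^ (p / 2), by positivity, ?_⟩
  intro n hn hn2 Ω _ μ _ X Y hX hY hind hXu hYu π hπm hπ
  obtain ⟨N, hN, hNle⟩ := hscale n hn hn2
  obtain ⟨V, hV0, hVint, hVle, hV⟩ := exists_dual_bound_uniform hN hX hY hind hXu hYu
  have hrate := transportRate_pos hn hn2
  obtain ⟨hint, hle⟩ := integral_matchingCost_le hp0 hp hn hX hY hπm hπ hV0 hVint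
    (mul_pos hC hrate) (hVle.trans hNle) hV
  refine ⟨hint, hle.trans (le_of_eq ?_)⟩
  rw [← rpow_mul_transportRate_rpow hn p, Real.mul_rpow hC.le hrate.le]
  ring
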